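/- Let $K$ be a field of characteristic zero. All operators are linear operators on $K[x]$: $D$ is the derivative, $\mathrm{x}$ is multiplication by $x$, and products are compositions. For an operator $U$ put $e^{U}=\sum_{j\ge 0}U^j/j!$, and for a scalar $c$ put $U^{c}=\sum_{j\ge0}\binom{c}{j}(U-1)^j$ with $\binom{c}{j}=c(c-1)\cdots(c-j+1)/j!$, whenever only finitely many terms of the series are nonzero on each polynomial. A delta operator is an operator $Q$ that commutes with all shifts $f(x)\mapsto f(x+a)$, $a\in K$, and for which $Qx$ is a nonzero constant. An umbral operator for a delta operator $Q$ is an invertible operator $\phi$ whose polynomials $\phi_n(x)=\phi x^n$ satisfy $Q\phi_n=n\phi_{n-1}$ for all $n\ge 0$ (so $Q\phi_0=0$), $\phi_0=1$, and $\phi_n(0)=0$ for $n>0$. **Proposition.** (a) Let $p\ge 1$ be an integer. The series for $L_p=e^{-\mathrm{x}D^{p+1}}$ is finite on each polynomial, the operator $(1-pD^p)^{1/p}$ is invertible with $p$-th power $1-pD^p$, and $L_p$ is the unique umbral operator for $$\Psi_p=\frac{D}{(1-pD^p)^{1/p}}.$$ For every $\alpha\in K$, the series for $e^{-\mathrm{x}D^{p+1}-\alpha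 pD^p}$ is finite on each polynomial, and the degenerate associated Laguerre operator $L_p^{(\alpha)}=(1-pD^p)^{\alpha}L_p$ satisfies $$L_p^{(\alpha)}=e^{-\mathrm{x}D^{p+1}-\alpha pD^p}.$$ For every $n\ge 0$ the polynomial $L^{(\alpha)}_{p,n}(x)=L_p^{(\alpha)}x^n$ is $$L^{(\alpha)}_{p,n}(x)=\sum_{k=0}^{\lfloor n/p\rfloor}\binom{\frac np+\alpha-1}{k}\frac{n!}{(n-pk)!}(-p)^k x^{n-pk},$$ and $f=L^{(\alpha)}_{p,n}$ solves the differential equation $$x\,p\,f^{(p+1)}+\alpha p^2 f^{(p)}-x f'+nf=0 .$$ (b) Let $p=0$ and $K=\mathbb R$ or $\mathbb C$, and let $e^U=\sum_j U^j/j!$ now mean that, for each polynomial $f$, the series $\sum_j U^jf/j!$ converges coefficient by coefficient to the polynomial $e^Uf$. Then $L_0=e^{-\mathrm{x}D}$ exists and is the unique umbral operator for $\Psi_0=e\,D$, where $e$ is Euler's number. For every $\alpha\in K$, with $L_0^{(\alpha)}=(1-0\cdot D^0)^{\alpha}L_0$, one has $L_0^{(\alpha)}=e^{-\mathrm{x}D^{0+1}-\alpha\cdot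 0\cdot D^0}$, and for every $n\ge0$ the polynomial $f=L_0^{(\alpha)}x^n$ solves the differential equation above with $p=0$. -/

import Mathlib

open Polynomial

noncomputable section

namespace Umbral

variable {K : Type*} [Field K]

/-- Linear operators on the space `K[X]` of univariate polynomials. Products are compositions. -/
abbrev Op (K : Type*) [Field K] : Type _ := Module.End K K[X]

/-- The derivative `D`. -/
def D : Op K := Polynomial.derivative

/-- The operator of multiplication by the variable, `f(x) ↦ x f(x)`. -/
def mulX : Op K := LinearMap.mulLeft K (X : K[X])

/-- The shift `E ^ a`, that is `f(x) ↦ f(x + a)`. -/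
def shift (a : K) : Op K := Polynomial.taylor a

/-- A series of operators `∑ T j` is pointwise finite if, applied to any given polynomial,
all but finitely many of its terms vanish. -/
def PointwiseFinite (T : ℕ → Op K) : Prop :=
  ∀ f : K[X], (Function.support fun j => T j f).Finite

open Classical in
/-- The operator `∑ T j`, for a pointwise finite series of operators (and `0` by convention
if the series is not pointwise finite). -/
def opSum (T : ℕ → Op K) : Op K :=
  if h : PointwiseFinite T then
    { toFun := fun f => ∑ᶠ j, T j f
      map_add' := fun f g => by
        simp only [map_add]
        exact finsum_add_distrib (h f) (h g)
      map_smul' := fun c f => by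
        simp only [map_smul, RingHom.id_apply]
        exact (smul_finsum' c (h f)).symm }
  else 0

/-- The terms `U ^ j / j!` of the exponential series of an operator. -/
def expTerm (U : Op K) (j : ℕ) : Op K := ((j.factorial : K)⁻¹) • U ^ j

/-- The exponential `e ^ U = ∑ U ^ j / j!`, as a pointwise finite series. -/
def expOp (U : Op K) : Op K := opSum (expTerm U)

/-- `V = ∑ U ^ j / j!`, where the series may be infinite: for every polynomial `f` the series
`∑ U ^ j f / j!` converges coefficient by coefficient to `V f`. -/
def HasExp {𝕜 : Type*} [RCLike 𝕜] (U V : Op 𝕜) : Prop :=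
  ∀ (f : 𝕜[X]) (k : ℕ), HasSum (fun j => (expTerm U j f).coeff k) ((V f).coeff k)

/-- The power `U ^ c = ∑ (c choose j) (U - 1) ^ j` of an operator with a scalar exponent,
where `c choose j = c (c - 1) ⋯ (c - j + 1) / j!`. -/
def genPow [CharZero K] (U : Op K) (c : K) : Op K :=
  opSum fun j => Ring.choose c j • (U - 1) ^ j

/-- A delta operator: it is shift-invariant and maps `x` to a nonzero constant. -/
structure IsDelta (Q : Op K) : Prop where
  shift_invariant : ∀ a : K, Q * shift a = shift a * Q
  map_X : ∃ c : K, c ≠ 0 ∧ Q X = C c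

/-- `φ` is an umbral operator for (is basic for) the delta operator `Q`; its basic sequence is
`φ_n(x) = φ x ^ n`. For `n = 0` the field `sheffer` reads `Q φ_0 = 0`. -/
structure IsUmbral (φ Q : Op K) : Prop where
  delta : IsDelta Q
  invertible : IsUnit φ
  sheffer : ∀ n : ℕ, Q (φ (X ^ n)) = (n : K) • φ (X ^ (n - 1))
  map_one : φ 1 = 1
  eval_zero : ∀ n : ℕ, 0 < n → (φ (X ^ n)).eval 0 = 0

/-- The operator `- x D ^ (p + 1) - α p D ^ p`. -/
def lagExponent (p : ℕ) (α : K) : Op K :=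
  -(mulX * D ^ (p + 1)) - (α * (p : K)) • D ^ p

/-- The operator `L_p = e ^ (- x D ^ (p + 1))`, for `p ≥ 1`. -/
def lagOp (p : ℕ) : Op K := expOp (-(mulX * D ^ (p + 1)))

/-- The operator `(1 - p D ^ p) ^ c`. -/
def lagPow [CharZero K] (p : ℕ) (c : K) : Op K := genPow (1 - (p : K) • D ^ p) c

/-- The quotient `Ψ_p = D / (1 - p D ^ p) ^ (1 / p)` of shift-invariant operators, whose
denominator is invertible. -/
def lagDelta [CharZero K] (p : ℕ) : Op K := D * Ring.inverse (lagPow p (1 / (p : K)))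

/-- The degenerate associated Laguerre operator `L_p^(α) = (1 - p D ^ p) ^ α L_p`, for `p ≥ 1`. -/
def lagAssoc [CharZero K] (p : ℕ) (α : K) : Op K := lagPow p α * lagOp p

/-- `f` solves `x p f^(p+1) + α p ^ 2 f^(p) - x f' + n f = 0`. -/
def SolvesLagODE (p : ℕ) (α : K) (n : ℕ) (f : K[X]) : Prop :=
  X * C (p : K) * derivative^[p + 1] f + C (α * (p : K) ^ 2) * derivative^[p] f
    - X * derivative f + C (n : K) * f = 0

end Umbral

end

open Umbral

/-! For `p ≥ 1` everything follows from one identity, `expOp_lagExponent_X_pow`: on `x^n`, the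
exponential of `U = -xD^(p+1) - αpD^p` acts as `(1 - pD^p)^(n/p + α - 1)`. Indeed `x D^(m+1) x^n =
(n - m) D^m x^n`, so `U` sends `D^m x^n` to a multiple of `D^(m+p) x^n`; iterating, the multiples
build a falling factorial, and `U^k/k!` yields a binomial coefficient. Power series in a locally
nilpotent operator multiply as series do (`opSeries_mul`), so `c ↦ (1 - pD^p)^c` turns sums into
products. Adding exponents gives the formula for `L_p^(α)` and the relation `Ψ_p φ_n = n φ_(n-1)`;
the binomial expansion gives the coefficients, and the differential equation telescopes along it.
For `p = 0`, `xD` is diagonal on monomials and its exponential is a rescaling of `x`. -/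

namespace Umbral

/-! ### Power series in locally nilpotent operators; derivatives of monomials -/

section Series

variable {K : Type*} [Field K]

/-- An operator is locally nilpotent if some power of it kills any given polynomial. -/
def LocallyNilpotent (U : Op K) : Prop := ∀ f : K[X], ∃ N : ℕ, (U ^ N) f = 0

/-- The operator `∑ a_j U ^ j` for a formal power series `∑ a_j t ^ j`. -/
noncomputable def opSeries (U : Op K) (a : PowerSeries K) : Op K :=
  opSum fun j => PowerSeries.coeff j a • U ^ j

theorem opSum_apply {T : ℕ → Op K} (h : PointwiseFinite T) (f : K[X]) :
    opSum T f = ∑ᶠ j, T j f := by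
  rw [opSum, dif_pos h]
  rfl

theorem pow_apply_eq_zero_of_le {U : Op K} {f : K[X]} {N j : ℕ} (h : (U ^ N) f = 0)
    (hj : N ≤ j) : (U ^ j) f = 0 := by
  obtain ⟨i, rfl⟩ := Nat.exists_eq_add_of_le' hj
  rw [pow_add, Module.End.mul_apply, h, map_zero]

theorem pointwiseFinite_smul_pow {U : Op K} (hU : LocallyNilpotent U) (a : ℕ → K) :
    PointwiseFinite fun j => a j • U ^ j := by
  intro f
  obtain ⟨N, hN⟩ := hU f
  refine (Set.finite_lt_nat N).subset fun j hj => ?_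
  by_contra hlt
  exact hj (by simp [pow_apply_eq_zero_of_le hN (not_lt.mp hlt)])

theorem opSeries_apply {U : Op K} (hU : LocallyNilpotent U) (a : PowerSeries K) {f : K[X]}
    {N : ℕ} (hN : (U ^ N) f = 0) :
    opSeries U a f = ∑ j ∈ Finset.range N, PowerSeries.coeff j a • (U ^ j) f := by
  rw [opSeries, opSum_apply (pointwiseFinite_smul_pow hU _)]
  refine finsum_eq_sum_of_support_subset _ fun j hj => ?_
  by_contra hlt
  refine hj ?_
  simp only [Finset.coe_range, Set.mem_Iio, not_lt] at hlt
  simp [pow_apply_eq_zero_of_le hN hlt]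

theorem aeval_apply_of_pow_apply_eq_zero {U : Op K} {f : K[X]} {N : ℕ} (hN : (U ^ N) f = 0)
    (r : K[X]) : aeval U r f = ∑ j ∈ Finset.range N, r.coeff j • (U ^ j) f := by
  have hlt : r.natDegree < N + r.natDegree + 1 := by omega
  rw [aeval_eq_sum_range' hlt, LinearMap.sum_apply]
  symm
  refine Finset.sum_subset (Finset.range_subset_range.mpr (by omega)) fun j _ hj => ?_
  rw [Finset.mem_range, not_lt] at hj
  simp [pow_apply_eq_zero_of_le hN hj]

theorem opSeries_apply_eq_aeval_trunc {U : Op K} (hU : LocallyNilpotent U) (a : PowerSeries K)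
    {f : K[X]} {N : ℕ} (hN : (U ^ N) f = 0) :
    opSeries U a f = aeval U (PowerSeries.trunc N a) f := by
  rw [opSeries_apply hU a hN, aeval_apply_of_pow_apply_eq_zero hN]
  refine Finset.sum_congr rfl fun j hj => ?_
  rw [PowerSeries.coeff_trunc, if_pos (Finset.mem_range.mp hj)]

theorem pow_apply_eq_zero_of_commute {U B : Op K} (hB : Commute U B) {f : K[X]} {N : ℕ}
    (hN : (U ^ N) f = 0) : (U ^ N) (B f) = 0 := by
  rw [← Module.End.mul_apply, (hB.pow_left N).eq, Module.End.mul_apply, hN, map_zero]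

theorem commute_aeval_self (U : Op K) (r : K[X]) : Commute U (aeval U r) := by
  have h := (Commute.all (X : K[X]) r).map (aeval U)
  rwa [aeval_X] at h

/-- On `f` with `U^N f = 0` both series may be truncated to polynomials in `U`, and `aeval U` is
multiplicative. The same `N` serves for the inner value, which commuting with `U` keeps in the
kernel of `U^N`. -/
theorem opSeries_mul {U : Op K} (hU : LocallyNilpotent U) (a b : PowerSeries K) :
    opSeries U (a * b) = opSeries U a * opSeries U b := by
  refine LinearMap.ext fun f => ?_
  obtain ⟨N, hN⟩ := hU f
  have hN' := pow_apply_eq_zero_of_commute (commute_aeval_self U (PowerSeries.trunc N b)) hN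
  rw [Module.End.mul_apply, opSeries_apply_eq_aeval_trunc hU b hN,
    opSeries_apply_eq_aeval_trunc hU a hN', ← Module.End.mul_apply, ← map_mul,
    aeval_apply_of_pow_apply_eq_zero hN, opSeries_apply hU _ hN]
  refine Finset.sum_congr rfl fun j hj => ?_
  rw [PowerSeries.coeff_mul_eq_coeff_trunc_mul_trunc a b (Finset.mem_range.mp hj),
    ← Polynomial.coe_mul, Polynomial.coeff_coe]

theorem opSeries_one {U : Op K} (hU : LocallyNilpotent U) : opSeries U 1 = 1 := by
  refine LinearMap.ext fun f => ?_
  obtain ⟨N, hN⟩ := hU f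
  have hN' : (U ^ (N + 1)) f = 0 := pow_apply_eq_zero_of_le hN (Nat.le_succ N)
  rw [opSeries_apply hU 1 hN', Finset.sum_range_succ']
  simp [PowerSeries.coeff_one]

theorem opSeries_commute {U B : Op K} (hU : LocallyNilpotent U) (hB : Commute U B)
    (a : PowerSeries K) : Commute (opSeries U a) B := by
  refine LinearMap.ext fun f => ?_
  obtain ⟨N, hN⟩ := hU f
  rw [Module.End.mul_apply, Module.End.mul_apply, opSeries_apply hU a hN,
    opSeries_apply hU a (pow_apply_eq_zero_of_commute hB hN), map_sum]
  refine Finset.sum_congr rfl fun j _ => ?_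
  rw [map_smul, ← Module.End.mul_apply, (hB.pow_left j).eq, Module.End.mul_apply]

theorem op_ext {S T : Op K} (h : ∀ n : ℕ, S (X ^ n) = T (X ^ n)) : S = T := by
  refine Polynomial.lhom_ext' fun n => LinearMap.ext_ring ?_
  simpa [← X_pow_eq_monomial] using h n

/-- An operator that strictly lowers degree is locally nilpotent; phrasing this by vanishing
coefficients needs no special case for `0`. -/
theorem LocallyNilpotent.of_coeff {U : Op K}
    (h : ∀ (n : ℕ) (f : K[X]), (∀ i, n + 1 ≤ i → f.coeff i = 0) →
      ∀ i, n ≤ i → (U f).coeff i = 0) : LocallyNilpotent U := by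
  have key : ∀ (N : ℕ) (f : K[X]), (∀ i, N ≤ i → f.coeff i = 0) → (U ^ N) f = 0 := by
    intro N
    induction N with
    | zero => intro f hf; ext i; simpa using hf i (Nat.zero_le i)
    | succ N ih =>
      intro f hf
      rw [pow_succ, Module.End.mul_apply]
      exact ih _ (h N f hf)
  exact fun f => ⟨f.natDegree + 1, key _ f fun i hi => coeff_eq_zero_of_natDegree_lt (by omega)⟩

theorem D_pow_apply (m : ℕ) (f : K[X]) : (D ^ m : Op K) f = derivative^[m] f := by
  rw [Module.End.pow_apply]
  rfl

theorem mulX_apply (f : K[X]) : mulX f = X * f := rfl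

theorem D_commute_shift (a : K) : Commute (D : Op K) (shift a) := by
  refine LinearMap.ext fun f => ?_
  simp [D, shift, taylor_apply, derivative_comp]

theorem coeff_D_pow_eq_zero {m n : ℕ} {f : K[X]} (hf : ∀ i, n ≤ i → f.coeff i = 0) {i : ℕ}
    (hi : n ≤ i + m) : ((D ^ m : Op K) f).coeff i = 0 := by
  rw [D_pow_apply, coeff_iterate_derivative, hf _ hi, smul_zero]

theorem iterate_derivative_X_pow_eq_zero {n m : ℕ} (h : n < m) :
    derivative^[m] (X ^ n : K[X]) = 0 := by
  rw [iterate_derivative_X_pow_eq_smul, Nat.descFactorial_of_lt h, Nat.cast_zero, zero_smul]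

theorem lagExponent_zero_right (p : ℕ) :
    lagExponent p (0 : K) = -(mulX * D ^ (p + 1)) := by
  simp [lagExponent]

theorem locallyNilpotent_smul_D_pow {p : ℕ} (hp : 1 ≤ p) (c : K) :
    LocallyNilpotent (c • D ^ p : Op K) := by
  refine LocallyNilpotent.of_coeff fun n f hf i hi => ?_
  simp [coeff_D_pow_eq_zero hf (m := p) (i := i) (by omega)]

theorem locallyNilpotent_lagExponent {p : ℕ} (hp : 1 ≤ p) (α : K) :
    LocallyNilpotent (lagExponent p α) := by
  refine LocallyNilpotent.of_coeff fun n f hf i hi => ?_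
  have h₁ : (X * (D ^ (p + 1) : Op K) f).coeff i = 0 := by
    cases i with
    | zero => simp
    | succ i => rw [coeff_X_mul, coeff_D_pow_eq_zero hf (by omega)]
  simp [lagExponent, mulX_apply, h₁, coeff_D_pow_eq_zero hf (m := p) (i := i) (by omega)]

theorem smul_D_pow_pow_apply (p k : ℕ) (c : K) (f : K[X]) :
    ((c • D ^ p : Op K) ^ k) f = c ^ k • derivative^[p * k] f := by
  rw [_root_.smul_pow, ← pow_mul, LinearMap.smul_apply, D_pow_apply]

theorem lagOp_eq (p : ℕ) : (lagOp p : Op K) = expOp (lagExponent p 0) := by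
  rw [lagExponent_zero_right, lagOp]

/-- Euler's identity for `D^m x^n`, homogeneous of degree `n - m`. Subtracting in `K` is harmless
for `m > n`, where both sides vanish. -/
theorem X_mul_derivative_iterate_X_pow (n m : ℕ) :
    X * derivative^[m + 1] (X ^ n : K[X]) =
      ((n : K) - m) • derivative^[m] (X ^ n : K[X]) := by
  simp only [iterate_derivative_X_pow_eq_smul, mul_smul_comm]
  rcases lt_trichotomy n m with h | rfl | h
  · rw [Nat.descFactorial_of_lt h, Nat.descFactorial_of_lt (by omega)]
    simp
  · rw [Nat.descFactorial_of_lt (Nat.lt_succ_self n)]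
    simp
  · obtain ⟨d, rfl⟩ := Nat.exists_eq_add_of_lt h
    rw [Nat.descFactorial_succ, smul_smul, ← pow_succ']
    have h₁ : m + d + 1 - (m + 1) + 1 = m + d + 1 - m := by omega
    have h₂ : m + d + 1 - m = d + 1 := by omega
    rw [h₁, h₂]
    congr 1
    push_cast
    ring

theorem smul_D_pow_pow_X_pow_eq_zero {p : ℕ} {n N : ℕ} (h : n < p * N) (c : K) :
    ((c • D ^ p : Op K) ^ N) (X ^ n) = 0 := by
  rw [smul_D_pow_pow_apply, iterate_derivative_X_pow_eq_zero h, smul_zero]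

theorem opSeries_smul_D_pow_X_pow {p : ℕ} (hp : 1 ≤ p) (c : K) (a : PowerSeries K) {n N : ℕ}
    (h : n < p * N) :
    opSeries (c • D ^ p) a (X ^ n) =
      ∑ k ∈ Finset.range N, (PowerSeries.coeff k a * c ^ k) • derivative^[p * k] (X ^ n) := by
  rw [opSeries_apply (locallyNilpotent_smul_D_pow hp c) a (smul_D_pow_pow_X_pow_eq_zero h c)]
  simp only [smul_D_pow_pow_apply, smul_smul]

end Series

/-! ### The powers of `1 - pD^p` and the exponential formula, `p ≥ 1` -/

section Positive

variable {K : Type*} [Field K] [CharZero K]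

theorem expOp_eq_opSeries (U : Op K) : expOp U = opSeries U (PowerSeries.exp K) := by
  unfold expOp opSeries expTerm
  simp [PowerSeries.coeff_exp]

theorem genPow_eq_opSeries (U : Op K) (c : K) :
    genPow U c = opSeries (U - 1) (PowerSeries.binomialSeries K c) := by
  simp [genPow, opSeries, PowerSeries.binomialSeries_coeff]

theorem isUnit_expOp {U : Op K} (hU : LocallyNilpotent U) : IsUnit (expOp U) := by
  have h := PowerSeries.exp_mul_exp_neg_eq_one (A := K)
  refine isUnit_iff_exists.mpr
    ⟨opSeries U (PowerSeries.evalNegHom (PowerSeries.exp K)), ?_, ?_⟩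
  · rw [expOp_eq_opSeries, ← opSeries_mul hU, h, opSeries_one hU]
  · rw [expOp_eq_opSeries, ← opSeries_mul hU, mul_comm, h, opSeries_one hU]

theorem succ_mul_choose_succ (c : K) (k : ℕ) :
    ((k : K) + 1) * Ring.choose c (k + 1) = (c - k) * Ring.choose c k := by
  have h := Ring.descPochhammer_eq_factorial_smul_choose c (k + 1)
  have h' := Ring.descPochhammer_eq_factorial_smul_choose c k
  rw [descPochhammer_succ_right, Polynomial.smeval_mul, h'] at h
  simp only [nsmul_eq_mul, Nat.factorial_succ, Nat.cast_mul, Polynomial.smeval_sub,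
    Polynomial.smeval_X, Polynomial.smeval_natCast, pow_one, pow_zero, Nat.cast_add,
    Nat.cast_one, mul_one] at h
  have hk : (k.factorial : K) ≠ 0 := Nat.cast_ne_zero.mpr k.factorial_ne_zero
  apply mul_left_cancel₀ hk
  linear_combination -h

theorem lagPow_eq_opSeries (p : ℕ) (c : K) :
    lagPow p c = opSeries ((-(p : K)) • D ^ p) (PowerSeries.binomialSeries K c) := by
  rw [lagPow, genPow_eq_opSeries]
  have h : (1 - (p : K) • D ^ p - 1 : Op K) = (-(p : K)) • D ^ p := by
    refine LinearMap.ext fun f => ?_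
    simp
  rw [h]

theorem lagPow_add {p : ℕ} (hp : 1 ≤ p) (a b : K) :
    lagPow p (a + b) = lagPow p a * lagPow p b := by
  simp only [lagPow_eq_opSeries]
  rw [PowerSeries.binomialSeries_add, opSeries_mul (locallyNilpotent_smul_D_pow hp _)]

theorem lagPow_zero {p : ℕ} (hp : 1 ≤ p) : lagPow p (0 : K) = 1 := by
  rw [lagPow_eq_opSeries, PowerSeries.binomialSeries_zero,
    opSeries_one (locallyNilpotent_smul_D_pow hp _)]

theorem lagPow_one {p : ℕ} (hp : 1 ≤ p) : lagPow p (1 : K) = 1 - (p : K) • D ^ p := by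
  have hM := locallyNilpotent_smul_D_pow (K := K) hp (-(p : K))
  rw [lagPow_eq_opSeries]
  refine LinearMap.ext fun f => ?_
  obtain ⟨N, hN⟩ := hM f
  -- The cutoff is raised by 2 to split off the terms `j = 0, 1`, the only nonzero ones for exponent
  -- 1.
  rw [opSeries_apply hM _ (pow_apply_eq_zero_of_le hN (Nat.le_add_right N 2)),
    Finset.sum_range_succ', Finset.sum_range_succ', Finset.sum_eq_zero]
  · simp [PowerSeries.binomialSeries_coeff]
    abel
  · intro j _
    have : Ring.choose (1 : K) (j + 1 + 1) = 0 := by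
      have := Ring.choose_natCast (R := K) 1 (j + 1 + 1)
      rw [Nat.choose_eq_zero_of_lt (by omega)] at this
      simpa using this
    simp [PowerSeries.binomialSeries_coeff, this]

theorem lagPow_pow {p : ℕ} (hp : 1 ≤ p) (c : K) (n : ℕ) :
    lagPow p c ^ n = lagPow p (n * c) := by
  induction n with
  | zero => simp [lagPow_zero hp]
  | succ n ih => rw [pow_succ, ih, ← lagPow_add hp]; congr 1; push_cast; ring

theorem isUnit_lagPow {p : ℕ} (hp : 1 ≤ p) (c : K) : IsUnit (lagPow p c) :=
  ⟨⟨lagPow p c, lagPow p (-c), by rw [← lagPow_add hp, add_neg_cancel, lagPow_zero hp],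
    by rw [← lagPow_add hp, neg_add_cancel, lagPow_zero hp]⟩, rfl⟩

theorem inverse_lagPow {p : ℕ} (hp : 1 ≤ p) (c : K) :
    Ring.inverse (lagPow p c) = lagPow p (-c) := by
  refine left_inv_eq_right_inv (Ring.inverse_mul_cancel _ (isUnit_lagPow hp c)) ?_
  rw [← lagPow_add hp, add_neg_cancel, lagPow_zero hp]

theorem lagPow_commute {p : ℕ} (hp : 1 ≤ p) (c : K) {B : Op K} (hB : Commute D B) :
    Commute (lagPow p c) B := by
  rw [lagPow_eq_opSeries]
  exact opSeries_commute (locallyNilpotent_smul_D_pow hp _) ((hB.pow_left p).smul_left _) _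

theorem lagExponent_iterate_derivative {p : ℕ} (hp : 1 ≤ p) (α : K) (n m : ℕ) :
    lagExponent p α (derivative^[m] (X ^ n)) =
      (-(p : K) * (((n : K) - m) / p + α - 1)) • derivative^[m + p] (X ^ n) := by
  have hp' : (p : K) ≠ 0 := Nat.cast_ne_zero.mpr (by omega)
  simp only [lagExponent, LinearMap.sub_apply, LinearMap.neg_apply, LinearMap.smul_apply,
    Module.End.mul_apply, mulX_apply, D_pow_apply, ← Function.iterate_add_apply]
  rw [show p + 1 + m = (m + p) + 1 by omega, X_mul_derivative_iterate_X_pow, add_comm p m,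
    ← neg_smul, ← sub_smul]
  congr 1
  push_cast
  field_simp
  ring

theorem lagExponent_pow_X_pow {p : ℕ} (hp : 1 ≤ p) (α : K) (n k : ℕ) :
    (lagExponent p α ^ k) (X ^ n) =
      ((k.factorial : K) * Ring.choose ((n : K) / p + α - 1) k * (-(p : K)) ^ k) •
        derivative^[p * k] (X ^ n) := by
  have hp' : (p : K) ≠ 0 := Nat.cast_ne_zero.mpr (by omega)
  induction k with
  | zero => simp
  | succ k ih =>
    rw [pow_succ', Module.End.mul_apply, ih, map_smul, lagExponent_iterate_derivative hp,
      smul_smul, mul_add_one p k]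
    congr 1
    have h := succ_mul_choose_succ ((n : K) / p + α - 1) k
    have e : ((n : K) - ((p * k : ℕ) : K)) / p + α - 1 = (n : K) / p + α - 1 - k := by
      push_cast
      field_simp
      ring
    rw [e, Nat.factorial_succ, pow_succ]
    push_cast
    linear_combination -(k.factorial : K) * (-(p : K)) ^ k * (-(p : K)) * h

/-- The factorial in `lagExponent_pow_X_pow` cancels that of the exponential, leaving a binomial
series in `-pD^p`. -/
theorem expOp_lagExponent_X_pow {p : ℕ} (hp : 1 ≤ p) (α : K) (n : ℕ) :
    expOp (lagExponent p α) (X ^ n) = lagPow p ((n : K) / p + α - 1) (X ^ n) := by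
  have h : n < p * (n + 1) := by nlinarith
  have hN : (lagExponent p α ^ (n + 1)) (X ^ n) = 0 := by
    rw [lagExponent_pow_X_pow hp, iterate_derivative_X_pow_eq_zero h, smul_zero]
  rw [expOp_eq_opSeries, opSeries_apply (locallyNilpotent_lagExponent hp α) _ hN,
    lagPow_eq_opSeries, opSeries_smul_D_pow_X_pow hp _ _ h]
  refine Finset.sum_congr rfl fun k _ => ?_
  have hk : (k.factorial : K) ≠ 0 := Nat.cast_ne_zero.mpr k.factorial_ne_zero
  rw [lagExponent_pow_X_pow hp, smul_smul]
  congr 1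
  simp only [PowerSeries.coeff_exp, PowerSeries.binomialSeries_coeff, map_div₀, map_one,
    map_natCast, smul_eq_mul, mul_one]
  field_simp

theorem lagAssoc_X_pow {p : ℕ} (hp : 1 ≤ p) (α : K) (n : ℕ) :
    lagAssoc p α (X ^ n) = lagPow p ((n : K) / p + α - 1) (X ^ n) := by
  rw [lagAssoc, lagOp_eq, Module.End.mul_apply, expOp_lagExponent_X_pow hp,
    ← Module.End.mul_apply, ← lagPow_add hp]
  congr 2
  ring

theorem lagAssoc_eq_expOp {p : ℕ} (hp : 1 ≤ p) (α : K) :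
    lagAssoc p α = expOp (lagExponent p α) :=
  op_ext fun n => by rw [lagAssoc_X_pow hp, expOp_lagExponent_X_pow hp]

theorem lagAssoc_X_pow_eq_sum {p : ℕ} (hp : 1 ≤ p) (α : K) {n N : ℕ} (h : n < p * N) :
    lagAssoc p α (X ^ n) = ∑ k ∈ Finset.range N,
      (Ring.choose ((n : K) / p + α - 1) k * (-(p : K)) ^ k) • derivative^[p * k] (X ^ n) := by
  rw [lagAssoc_X_pow hp, lagPow_eq_opSeries, opSeries_smul_D_pow_X_pow hp _ _ h]
  simp [PowerSeries.binomialSeries_coeff]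

theorem lagAssoc_X_pow_explicit {p : ℕ} (hp : 1 ≤ p) (α : K) (n : ℕ) :
    lagAssoc p α (X ^ n) =
      ∑ k ∈ Finset.range (n / p + 1),
        C (Ring.choose ((n : K) / (p : K) + α - 1) k *
          ((n.factorial : K) / ((n - p * k).factorial : K)) * (-(p : K)) ^ k) *
          X ^ (n - p * k) := by
  rw [lagAssoc_X_pow_eq_sum hp α (Nat.lt_mul_div_succ n hp)]
  refine Finset.sum_congr rfl fun k hk => ?_
  have hle : p * k ≤ n := by
    have := (Nat.le_div_iff_mul_le hp).mp (Nat.lt_succ_iff.mp (Finset.mem_range.mp hk))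
    rwa [mul_comm]
  have hfac : ((n - p * k).factorial : K) ≠ 0 := Nat.cast_ne_zero.mpr (Nat.factorial_ne_zero _)
  rw [iterate_derivative_X_pow_eq_smul, smul_smul, smul_eq_C_mul]
  congr 2
  rw [← Nat.factorial_mul_descFactorial hle]
  push_cast
  field_simp

theorem solvesLagODE_lagAssoc {p : ℕ} (hp : 1 ≤ p) (α : K) (n : ℕ) :
    SolvesLagODE p α n (lagAssoc p α (X ^ n)) := by
  have hp' : (p : K) ≠ 0 := Nat.cast_ne_zero.mpr (by omega)
  have h : n < p * (n + 1) := by nlinarith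
  set c : ℕ → K := fun k => Ring.choose ((n : K) / p + α - 1) k * (-(p : K)) ^ k with hc
  -- The operator of the equation maps the `k`-th term of the expansion to `g k - g (k + 1)`.
  set g : ℕ → K[X] := fun k => ((p : K) * k * c k) • derivative^[p * k] (X ^ n) with hg
  have hsum : lagAssoc p α (X ^ n) =
      ∑ k ∈ Finset.range (n + 1), c k • derivative^[p * k] (X ^ n) :=
    lagAssoc_X_pow_eq_sum hp α h
  -- The left side of the equation is `-pU - xD + n`, with `U` the Laguerre exponent.
  let T : Op K := (-(p : K)) • lagExponent p α - mulX * D ^ 1 + (n : K) • 1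
  have hT : ∀ f : K[X], X * C (p : K) * derivative^[p + 1] f
      + C (α * (p : K) ^ 2) * derivative^[p] f - X * derivative f + C (n : K) * f = T f := by
    intro f
    simp only [T, lagExponent, LinearMap.sub_apply, LinearMap.add_apply, LinearMap.neg_apply,
      LinearMap.smul_apply, Module.End.mul_apply, Module.End.one_apply, mulX_apply, D_pow_apply,
      Function.iterate_one, smul_eq_C_mul, map_mul, map_neg, map_pow]
    ring
  have hterm : ∀ k, T (c k • derivative^[p * k] (X ^ n)) = g k - g (k + 1) := by
    intro k
    have hch := succ_mul_choose_succ ((n : K) / p + α - 1) k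
    simp only [T, LinearMap.sub_apply, LinearMap.add_apply, LinearMap.smul_apply,
      Module.End.mul_apply, Module.End.one_apply, mulX_apply, map_smul,
      lagExponent_iterate_derivative hp, D_pow_apply, ← Function.iterate_add_apply]
    rw [add_comm 1, X_mul_derivative_iterate_X_pow]
    simp only [hg, mul_add_one p k]
    have e : (p : K) * ((k + 1 : ℕ) : K) * c (k + 1) =
        -((p : K) * p * ((n : K) / p + α - 1 - k) * c k) := by
      simp only [hc, pow_succ]
      push_cast
      linear_combination -(p : K) * p * (-(p : K)) ^ k * hch
    rw [e]
    simp only [smul_smul, neg_smul, sub_neg_eq_add]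
    have e₂ : ((n : K) - ((p * k : ℕ) : K)) / p + α - 1 = (n : K) / p + α - 1 - k := by
      push_cast
      field_simp
      ring
    rw [e₂]
    push_cast
    module
  rw [SolvesLagODE, hT, hsum, map_sum, Finset.sum_congr rfl fun k _ => hterm k,
    Finset.sum_range_sub']
  -- Both ends vanish: `g 0` by its factor `k`, `g (n + 1)` because it differentiates `x^n` more
  -- than `n` times.
  simp [hg, iterate_derivative_X_pow_eq_zero (K := K) h]

end Positive

/-! ### Uniqueness of umbral operators, and `L_p` as one for `Ψ_p` -/

section Umbral

variable {K : Type*} [Field K] [CharZero K]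

/-- By induction `Q` kills the difference of the `n`-th polynomials, so it is constant, and its
value at 0 is 0. -/
theorem IsUmbral.unique {φ ψ Q : Op K} (hφ : IsUmbral φ Q) (hψ : IsUmbral ψ Q)
    (hker : ∀ f : K[X], Q f = 0 → derivative f = 0) : φ = ψ := by
  refine op_ext fun n => ?_
  induction n with
  | zero => rw [pow_zero, hφ.map_one, hψ.map_one]
  | succ n ih =>
    have h : Q (φ (X ^ (n + 1)) - ψ (X ^ (n + 1))) = 0 := by
      rw [map_sub, hφ.sheffer, hψ.sheffer, Nat.add_sub_cancel, ih, sub_self]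
    have hconst := eq_C_of_derivative_eq_zero (hker _ h)
    have h₀ : (φ (X ^ (n + 1)) - ψ (X ^ (n + 1))).coeff 0 = 0 := by
      rw [coeff_zero_eq_eval_zero, eval_sub, hφ.eval_zero _ n.succ_pos,
        hψ.eval_zero _ n.succ_pos, sub_self]
    rw [h₀, map_zero] at hconst
    exact sub_eq_zero.mp hconst

theorem lagDelta_eq {p : ℕ} (hp : 1 ≤ p) :
    (lagDelta p : Op K) = D * lagPow p (-(1 / (p : K))) := by
  rw [lagDelta, inverse_lagPow hp]

theorem derivative_eq_zero_of_lagDelta {p : ℕ} (hp : 1 ≤ p) {f : K[X]}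
    (h : lagDelta p f = 0) : derivative f = 0 := by
  rw [lagDelta_eq hp, ← (lagPow_commute hp _ (Commute.refl D)).eq, Module.End.mul_apply] at h
  have := congrArg (lagPow p (1 / (p : K))) h
  rwa [← Module.End.mul_apply, ← lagPow_add hp, add_neg_cancel, lagPow_zero hp, map_zero,
    Module.End.one_apply] at this

theorem isDelta_lagDelta {p : ℕ} (hp : 1 ≤ p) : IsDelta (lagDelta p : Op K) where
  shift_invariant a := by
    rw [lagDelta_eq hp]
    exact (D_commute_shift a).mul_left (lagPow_commute hp _ (D_commute_shift a))
  map_X := by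
    refine ⟨1, one_ne_zero, ?_⟩
    have hM := locallyNilpotent_smul_D_pow (K := K) hp (-(p : K))
    have h1 : (((-(p : K)) • D ^ p : Op K) ^ 1) (1 : K[X]) = 0 := by
      simpa using smul_D_pow_pow_X_pow_eq_zero (n := 0) (N := 1) (by omega : 0 < p * 1) (-(p : K))
    rw [lagDelta_eq hp, ← (lagPow_commute hp _ (Commute.refl D)).eq, Module.End.mul_apply,
      lagPow_eq_opSeries, D, derivative_X]
    erw [opSeries_apply hM _ h1]
    simp [PowerSeries.binomialSeries_coeff]

theorem isUmbral_lagOp {p : ℕ} (hp : 1 ≤ p) : IsUmbral (lagOp p : Op K) (lagDelta p) where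
  delta := isDelta_lagDelta hp
  invertible := by
    rw [lagOp_eq]
    exact isUnit_expOp (locallyNilpotent_lagExponent hp 0)
  sheffer n := by
    have hp' : (p : K) ≠ 0 := Nat.cast_ne_zero.mpr (by omega)
    rw [lagDelta_eq hp, lagOp_eq, expOp_lagExponent_X_pow hp, expOp_lagExponent_X_pow hp,
      ← (lagPow_commute hp _ (Commute.refl D)).eq, Module.End.mul_apply, ← Module.End.mul_apply D,
      ← (lagPow_commute hp _ (Commute.refl D)).eq, Module.End.mul_apply, ← Module.End.mul_apply,
      ← lagPow_add hp]
    rcases n with _ | n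
    · simp [D]
    · simp only [D, derivative_X_pow, Nat.add_sub_cancel, ← smul_eq_C_mul, map_smul]
      -- Compares exponents: `-1/p + (n+1)/p - 1 = n/p - 1`.
      congr 3
      push_cast
      field_simp
      ring
  map_one := by
    have h := lagAssoc_X_pow_explicit hp (0 : K) 0
    simpa [lagAssoc, lagPow_zero hp] using h
  eval_zero n hn := by
    have hp' : (p : K) ≠ 0 := Nat.cast_ne_zero.mpr (by omega)
    have h := lagAssoc_X_pow_explicit hp (0 : K) n
    rw [lagAssoc, lagPow_zero hp, one_mul] at h
    rw [h, eval_finsetSum]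
    refine Finset.sum_eq_zero fun k hk => ?_
    have hle : p * k ≤ n := by
      have := (Nat.le_div_iff_mul_le hp).mp (Nat.lt_succ_iff.mp (Finset.mem_range.mp hk))
      rwa [mul_comm]
    rcases hle.lt_or_eq with hlt | rfl
    · simp [Nat.sub_eq_zero_iff_le, hlt]
    -- The constant term occurs only for `n = pk`, with coefficient a multiple of `(k-1 choose k) =
    -- 0`.
    · have hk : 0 < k := Nat.pos_of_mul_pos_left hn
      obtain ⟨k, rfl⟩ := Nat.exists_eq_succ_of_ne_zero hk.ne'
      have e : ((p * (k + 1) : ℕ) : K) / p + 0 - 1 = (k : ℕ) := by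
        push_cast
        field_simp
        ring
      rw [Nat.succ_eq_add_one, e, Ring.choose_natCast, Nat.choose_succ_self]
      simp

end Umbral

/-! ### The case `p = 0`: rescaling the variable -/

section Zero

variable {𝕜 : Type*} [RCLike 𝕜]

/-- The substitution `f(x) ↦ f(a x)`. -/
noncomputable def scale (a : 𝕜) : Op 𝕜 := (aeval (C a * X : 𝕜[X])).toLinearMap

theorem coeff_scale (a : 𝕜) (f : 𝕜[X]) (k : ℕ) : (scale a f).coeff k = f.coeff k * a ^ k := by
  rw [scale, AlgHom.toLinearMap_apply, ← comp_eq_aeval, comp_C_mul_X_coeff]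

theorem scale_mul (a b : 𝕜) : scale a * scale b = scale (a * b) := by
  refine LinearMap.ext fun f => ?_
  ext k
  rw [Module.End.mul_apply, coeff_scale, coeff_scale, coeff_scale, mul_pow]
  ring

theorem scale_one : scale (1 : 𝕜) = 1 := by
  refine LinearMap.ext fun f => ?_
  ext k
  rw [coeff_scale, one_pow, mul_one, Module.End.one_apply]

theorem scale_X_pow (a : 𝕜) (n : ℕ) : scale a (X ^ n) = a ^ n • X ^ n := by
  simp [scale, mul_pow, smul_eq_C_mul]

theorem coeff_neg_mulX_mul_D_pow (f : 𝕜[X]) (j k : ℕ) :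
    (((-(mulX * D ^ (0 + 1)) : Op 𝕜) ^ j) f).coeff k = (-(k : 𝕜)) ^ j * f.coeff k := by
  induction j with
  | zero => simp
  | succ j ih =>
    rw [pow_succ', Module.End.mul_apply, pow_succ' (-(k : 𝕜)), mul_assoc, ← ih]
    cases k with
    | zero => simp [mulX_apply]
    | succ k =>
      simp only [LinearMap.neg_apply, Module.End.mul_apply, mulX_apply, zero_add, D_pow_apply,
        Function.iterate_one, coeff_neg, coeff_X_mul, coeff_derivative]
      push_cast
      ring

/-- The `k`-th coefficient is scaled by the eigenvalue `-k` of `-xD`, so its series sums to the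
factor `exp(-k) = (e⁻¹)^k`. -/
theorem hasExp_neg_mulX_mul_D :
    HasExp (-(mulX * D ^ (0 + 1)) : Op 𝕜) (scale (((Real.exp 1 : ℝ) : 𝕜)⁻¹)) := by
  intro f k
  have h := (NormedSpace.expSeries_div_hasSum_exp (-(k : 𝕜))).mul_right (f.coeff k)
  have e : NormedSpace.exp (-(k : 𝕜)) = (((Real.exp 1 : ℝ) : 𝕜)⁻¹) ^ k := by
    -- Reduces to `exp(-1)` in `𝕜`, the image of the real exponential.
    have h₁ : (-(k : 𝕜)) = k • ((-1 : ℝ) : 𝕜) := by simp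
    rw [h₁, NormedSpace.exp_nsmul, ← RCLike.ofReal_inv, ← Real.exp_neg, Real.exp_eq_exp_ℝ]
    congr 1
    exact (NormedSpace.map_exp (RCLike.ofRealAm (K := 𝕜)) RCLike.continuous_ofReal (-1)).symm
  rw [coeff_scale, mul_comm, ← e]
  refine h.congr_fun ?_
  intro j
  simp only [expTerm, LinearMap.smul_apply, coeff_smul, coeff_neg_mulX_mul_D_pow, smul_eq_mul]
  ring

theorem isUmbral_scale {e : 𝕜} (he : e ≠ 0) : IsUmbral (scale e⁻¹) (e • D : Op 𝕜) where
  delta :=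
    { shift_invariant := fun a => (D_commute_shift a).smul_left e
      map_X := ⟨e, he, by simp [D, smul_eq_C_mul]⟩ }
  invertible := ⟨⟨scale e⁻¹, scale e, by rw [scale_mul, inv_mul_cancel₀ he, scale_one],
    by rw [scale_mul, mul_inv_cancel₀ he, scale_one]⟩, rfl⟩
  sheffer n := by
    rcases n with _ | n
    · rw [scale_X_pow]
      simp [D]
    · simp only [scale_X_pow, LinearMap.smul_apply, map_smul, D, derivative_X_pow,
        Nat.add_sub_cancel, ← smul_eq_C_mul, smul_smul]
      congr 1
      rw [pow_succ]
      field_simp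
  map_one := by simpa using scale_X_pow e⁻¹ 0
  eval_zero n hn := by simp [scale_X_pow, hn.ne']

theorem genPow_one {K : Type*} [Field K] [CharZero K] (c : K) : genPow (1 : Op K) c = 1 := by
  have h : LocallyNilpotent (0 : Op K) := fun f => ⟨1, by simp⟩
  rw [genPow_eq_opSeries, sub_self]
  refine LinearMap.ext fun f => ?_
  rw [opSeries_apply h _ (N := 1) (by simp)]
  simp [PowerSeries.binomialSeries_coeff]

theorem lagPow_zero_left (α : 𝕜) : lagPow 0 α = 1 := by
  simp [lagPow, genPow_one]

theorem solvesLagODE_scale (a α : 𝕜) (n : ℕ) : SolvesLagODE 0 α n (scale a (X ^ n)) := by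
  rw [SolvesLagODE, scale_X_pow]
  rcases n with _ | n
  · simp
  · simp only [smul_eq_C_mul, derivative_C_mul, derivative_X_pow, Nat.add_sub_cancel]
    simp
    ring

end Zero

end Umbral

theorem mainTheorem12 {K : Type*} [Field K] [CharZero K] {𝕜 : Type*} [RCLike 𝕜] :
    -- the case `p ≥ 1`, over any field of characteristic zero
    (∀ p : ℕ, 1 ≤ p →
      -- `L_p` is given by a pointwise finite exponential series, the denominator of `Ψ_p` is an
      -- invertible `p`-th root of `1 - p D ^ p`, and `L_p` is the umbral operator for `Ψ_p`
      (PointwiseFinite (expTerm (-(mulX * D ^ (p + 1)) : Op K)) ∧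
        IsUnit (lagPow p (1 / (p : K))) ∧
        lagPow p (1 / (p : K)) ^ p = 1 - (p : K) • D ^ p ∧
        ∀ φ : Op K, IsUmbral φ (lagDelta p) ↔ φ = lagOp p) ∧
      ∀ α : K,
        -- `L_p^(α) = e ^ (- x D ^ (p + 1) - α p D ^ p)`
        (PointwiseFinite (expTerm (lagExponent p α)) ∧
          lagAssoc p α = expOp (lagExponent p α)) ∧
        ∀ n : ℕ,
          lagAssoc p α (X ^ n) =
            ∑ k ∈ Finset.range (n / p + 1),
              C (Ring.choose ((n : K) / (p : K) + α - 1) k *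
                ((n.factorial : K) / ((n - p * k).factorial : K)) * (-(p : K)) ^ k) *
                X ^ (n - p * k) ∧
          SolvesLagODE p α n (lagAssoc p α (X ^ n))) ∧
    -- the case `p = 0`, over the real or complex numbers
    (∃ L : Op 𝕜, HasExp (-(mulX * D ^ (0 + 1))) L ∧
      (∀ φ : Op 𝕜, IsUmbral φ (((Real.exp 1 : ℝ) : 𝕜) • D) ↔ φ = L) ∧
      ∀ α : 𝕜, HasExp (lagExponent 0 α) (lagPow 0 α * L) ∧
        ∀ n : ℕ, SolvesLagODE 0 α n ((lagPow 0 α * L) (X ^ n))) := by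
  refine ⟨fun p hp => ⟨⟨?_, isUnit_lagPow hp _, ?_, fun φ => ⟨fun h => ?_, ?_⟩⟩, fun α =>
    ⟨⟨?_, lagAssoc_eq_expOp hp α⟩, fun n =>
      ⟨lagAssoc_X_pow_explicit hp α n, solvesLagODE_lagAssoc hp α n⟩⟩⟩, ?_⟩
  · rw [← lagExponent_zero_right]
    exact pointwiseFinite_smul_pow (locallyNilpotent_lagExponent hp 0) _
  · have hp' : (p : K) ≠ 0 := Nat.cast_ne_zero.mpr (by omega)
    rw [lagPow_pow hp, mul_one_div_cancel hp', lagPow_one hp]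
  · exact h.unique (isUmbral_lagOp hp) fun f => derivative_eq_zero_of_lagDelta hp
  · rintro rfl
    exact isUmbral_lagOp hp
  · exact pointwiseFinite_smul_pow (locallyNilpotent_lagExponent hp α) _
  · have he : ((Real.exp 1 : ℝ) : 𝕜) ≠ 0 := RCLike.ofReal_ne_zero.mpr (Real.exp_ne_zero 1)
    refine ⟨scale (((Real.exp 1 : ℝ) : 𝕜)⁻¹), hasExp_neg_mulX_mul_D,
      fun φ => ⟨fun h => h.unique (isUmbral_scale he) fun f hf => ?_, ?_⟩, fun α => ?_⟩
    · exact (smul_eq_zero.mp hf).resolve_left he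
    · rintro rfl
      exact isUmbral_scale he
    · rw [lagPow_zero_left, one_mul]
      refine ⟨?_, fun n => solvesLagODE_scale _ α n⟩
      have : lagExponent 0 α = -(mulX * D ^ (0 + 1)) := by simp [lagExponent]
      rw [this]
      exact hasExp_neg_mulX_mul_D
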